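/- **Setting.** Let $\Omega\subset\mathbb R^3$ be a bounded open set, $W^1=W^2=L^2(\Omega;\mathbb R^3)$, $W^3=L^2(\Omega)$, with $L^2$ inner product $\langle\cdot,\cdot\rangle$ and norm $\|\cdot\|$. Let $V^1\subset H(\mathrm{curl},\Omega)$ and $V^2\subset H(\mathrm{div},\Omega)$ be subspaces, dense in $W^1$ and $W^2$, such that the restrictions $d=d^1:V^1\to W^2$ of the weak curl and $d=d^2:V^2\to W^3$ of the weak divergence are closed operators and $d^1V^1\subset V^2$; put $V^3=W^3$ (for example $V^1=H(\mathrm{curl},\Omega)$, $V^2=H(\mathrm{div},\Omega)$, or $V^1=H_0(\mathrm{curl},\Omega)$, $V^2=H_0(\mathrm{div},\Omega)$). Let $d^*:V^*_2\to W^1$ and $d^*:V^*_3\to W^2$ be the Hilbert space adjoints of $(d^1,V^1)$ and $(d^2,V^2)$, where $V^*_2\subset W^2$ and $V^*_3\subset W^3$ are their domains, and let $\mathfrak H^3=(dV^2)^\perp\subset W^3$. All domains carry graph norms: $\|u\|_V=\|u\|+\|du\|$ on $V^1,V^2$, $\|v\|+\|d^*v\|$ on $V_2^*,V_3^*$, $\|u\|+\|du\|+\|d^*u\|$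 on $V^2\cap V_2^*$; on $V^3$ and $\mathfrak H^3$ the norm is $\|\cdot\|$. Let $\nu>0$ and let $l_3:W^1\to W^2$, $l_5:W^2\to W^2$ be bounded linear maps with Hilbert space adjoints $l_3^*,l_5^*$. Define the bounded linear operators $$\overline{L_1},\ \overline{L_1'}:\ (V^2\cap V^*_2)\times(V^*_3\cap\mathfrak H^{3\perp})\longrightarrow (V^*_2\times(W^3\cap\mathfrak H^{3\perp}))'$$ by $$\overline{L_1}(u,p)(v,q)=\langle\nu d^*u,d^*v\rangle+\langle l_3d^*u+l_5u-d^*p,v\rangle+\langle du,q\rangle,$$ $$\overline{L_1'}(u,p)(v,q)=\langle\nu d^*u+l_3^*u,d^*v\rangle+\langle l_5^*u+d^*p,v\rangle+\langle-du,q\rangle.$$ Write $W=W^2\times(W^3\cap\mathfrak H^{3\perp})$, regarded as a subspace of $(V^*_2\times(W^3\cap\mathfrak H^{3\perp}))'$ through $(f_2,f_3)\mapsto\big((v,q)\mapsto\langle f_2,v\rangle+\langle f_3,q\rangle\big)$, and let a subscript $2$ on an operator denote the first component ($u$) of its value. On $V=V^1\times V^2\times V^3\times\mathfrak H^3$, with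 norm $\|\mathbf u\|_V=\|u_1\|_V+\|u_2\|_V+\|u_3\|+\|u_p\|$ for $\mathbf u=(u_1,u_2,u_3,u_p)$, let $$B(\mathbf u,\mathbf v)=\langle u_1,v_1\rangle-\langle u_2,dv_1\rangle+\nu\langle du_1,v_2\rangle-\langle u_3,dv_2\rangle+\langle du_2,v_3\rangle+\langle l_3u_1,v_2\rangle+\langle l_5u_2,v_2\rangle+\langle u_p,v_3\rangle+\langle u_3,v_p\rangle.$$ **Theorem.** Assume that $\overline{L_1}$ and $\overline{L_1'}$ are bounded isomorphisms (with bounded inverses), put $K=(\overline{L_1'})^{-1}$, and assume the regularity property $$d^*(\overline{L_1}^{-1})_2(W)\subset V^1,\qquad(\nu d^*+l_3^*)(K)_2(W)\subset V^1.$$ Then the mixed problem is well-posed: there is a constant $c>0$ such that for all $f_2\in W^2$ and $f_3\in W^3$ (in particular for all $(f_2,f_3)\in W$) there is exactly one $\mathbf u\in V$ with $$B(\mathbf u,\mathbf v)=\langle f_2,v_2\rangle+\langle f_3,v_3\rangle\qquad\text{for all }\mathbf v\in V,$$ and it satisfies $\|\mathbf u\|_V\le c\,(\|f_2\|+\|f_3\|)$.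 More generally, there is a constant $c>0$ such that for every bounded linear functional $F$ on $V$ there is exactly one $\mathbf u\in V$ with $B(\mathbf u,\mathbf v)=F(\mathbf v)$ for all $\mathbf v\in V$, and $\|\mathbf u\|_V\le c\,\|F\|_{V'}$. -/

import Mathlib

open MeasureTheory Filter Topology
open scoped ContDiff InnerProductSpace

noncomputable section

namespace VorticityMixed

/-! ### The `L²` spaces and the weak exterior derivatives on an open set of `ℝ³` -/

/-- Euclidean space `ℝ³`. -/
abbrev R3 : Type := EuclideanSpace ℝ (Fin 3)

/-- `L²(Ω; ℝ³)`: the space `W¹ = W²` of square integrable vector fields. -/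
abbrev L2Vec (Ω : Set R3) : Type := Lp R3 2 (volume.restrict Ω)

/-- `L²(Ω)`: the space `W³` of square integrable functions. -/
abbrev L2Scal (Ω : Set R3) : Type := Lp ℝ 2 (volume.restrict Ω)

/-- Smooth maps with compact support contained in `Ω`. -/
structure IsTest {F : Type} [NormedAddCommGroup F] [NormedSpace ℝ F]
    (Ω : Set R3) (φ : R3 → F) : Prop where
  smooth : ContDiff ℝ ∞ φ
  compact : HasCompactSupport φ
  supp : tsupport φ ⊆ Ω

/-- The classical partial derivative `∂ᵢ φⱼ` of a vector field at `x`. -/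
def partialD (φ : R3 → R3) (i j : Fin 3) (x : R3) : ℝ :=
  fderiv ℝ φ x (EuclideanSpace.single i 1) j

/-- The classical curl of a vector field. -/
def curl (φ : R3 → R3) (x : R3) : R3 :=
  !₂[partialD φ 1 2 x - partialD φ 2 1 x,
     partialD φ 2 0 x - partialD φ 0 2 x,
     partialD φ 0 1 x - partialD φ 1 0 x]

/-- `w` is the weak curl of `u` in `Ω`. -/
def IsWeakCurl (Ω : Set R3) (u w : L2Vec Ω) : Prop :=
  ∀ φ : R3 → R3, IsTest Ω φ → ∫ x in Ω, ⟪u x, curl φ x⟫_ℝ = ∫ x in Ω, ⟪w x, φ x⟫_ℝ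

/-- `w` is the weak divergence of `u` in `Ω`. -/
def IsWeakDiv (Ω : Set R3) (u : L2Vec Ω) (w : L2Scal Ω) : Prop :=
  ∀ φ : R3 → ℝ, IsTest Ω φ → ∫ x in Ω, ⟪u x, gradient φ x⟫_ℝ = - ∫ x in Ω, w x * φ x

section Pairing

variable {Ω : Set R3} {F : Type} [NormedAddCommGroup F] [InnerProductSpace ℝ F]

theorem integral_inner_eq (u : Lp F 2 (volume.restrict Ω)) {ψ : R3 → F} (hc : Continuous ψ)
    (hs : HasCompactSupport ψ) :
    ∫ x in Ω, ⟪u x, ψ x⟫_ℝ =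
      ⟪u, (hc.memLp_of_hasCompactSupport hs : MemLp ψ 2 (volume.restrict Ω)).toLp ψ⟫_ℝ := by
  rw [L2.inner_def]
  refine integral_congr_ae ?_
  filter_upwards [(hc.memLp_of_hasCompactSupport hs :
    MemLp ψ 2 (volume.restrict Ω)).coeFn_toLp] with x hx
  rw [hx]

theorem continuous_curl {φ : R3 → R3} (h : ContDiff ℝ ∞ φ) : Continuous (curl φ) := by
  have h1 : Continuous (fderiv ℝ φ) := h.continuous_fderiv (by simp)
  unfold curl partialD
  refine (PiLp.continuous_toLp 2 _).comp ?_
  refine continuous_pi fun i => ?_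
  fin_cases i <;> simp <;> fun_prop

theorem hasCompactSupport_curl {φ : R3 → R3} (h : HasCompactSupport φ) :
    HasCompactSupport (curl φ) := by
  have h1 : HasCompactSupport (fderiv ℝ φ) := h.fderiv ℝ
  refine h1.mono ?_
  intro x hx hx'
  apply hx
  have : fderiv ℝ φ x = 0 := hx'
  ext i
  fin_cases i <;> simp [curl, partialD, this]

theorem continuous_gradient {φ : R3 → ℝ} (h : ContDiff ℝ ∞ φ) : Continuous (gradient φ) := by
  have h1 : Continuous (fderiv ℝ φ) := h.continuous_fderiv (by simp)
  unfold gradient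
  fun_prop

theorem hasCompactSupport_gradient {φ : R3 → ℝ} (h : HasCompactSupport φ) :
    HasCompactSupport (gradient φ) := by
  have h1 : HasCompactSupport (fderiv ℝ φ) := h.fderiv ℝ
  refine h1.mono ?_
  intro x hx hx'
  apply hx
  have : fderiv ℝ φ x = 0 := hx'
  simp [gradient, this]

theorem isWeakCurl_iff (u w : L2Vec Ω) : IsWeakCurl Ω u w ↔ ∀ φ : R3 → R3, ∀ h : IsTest Ω φ,
    ⟪u, ((continuous_curl h.smooth).memLp_of_hasCompactSupport
      (hasCompactSupport_curl h.compact)).toLp (curl φ)⟫_ℝ =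
    ⟪w, (h.smooth.continuous.memLp_of_hasCompactSupport h.compact).toLp φ⟫_ℝ := by
  refine forall₂_congr fun φ h => ?_
  rw [integral_inner_eq u (continuous_curl h.smooth) (hasCompactSupport_curl h.compact),
    integral_inner_eq w h.smooth.continuous h.compact]

theorem isWeakDiv_iff (u : L2Vec Ω) (w : L2Scal Ω) :
    IsWeakDiv Ω u w ↔ ∀ φ : R3 → ℝ, ∀ h : IsTest Ω φ,
    ⟪u, ((continuous_gradient h.smooth).memLp_of_hasCompactSupport
      (hasCompactSupport_gradient h.compact)).toLp (gradient φ)⟫_ℝ =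
    - ⟪w, (h.smooth.continuous.memLp_of_hasCompactSupport h.compact).toLp φ⟫_ℝ := by
  refine forall₂_congr fun φ h => ?_
  rw [integral_inner_eq u (continuous_gradient h.smooth) (hasCompactSupport_gradient h.compact),
    ← integral_inner_eq w h.smooth.continuous h.compact]
  simp [mul_comm]

end Pairing

/-- The graph of the weak curl. -/
def curlGraph (Ω : Set R3) : Submodule ℝ (L2Vec Ω × L2Vec Ω) where
  carrier := {x | IsWeakCurl Ω x.1 x.2}
  zero_mem' := by
    simp only [Set.mem_ofPred_eq, isWeakCurl_iff]
    intro φ h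
    simp
  add_mem' {x y} hx hy := by
    simp only [Set.mem_ofPred_eq, isWeakCurl_iff] at *
    intro φ h
    simp only [Prod.fst_add, Prod.snd_add, inner_add_left, hx φ h, hy φ h]
  smul_mem' c x hx := by
    simp only [Set.mem_ofPred_eq, isWeakCurl_iff] at *
    intro φ h
    simp only [Prod.smul_fst, Prod.smul_snd, real_inner_smul_left, hx φ h]

/-- The graph of the weak divergence. -/
def divGraph (Ω : Set R3) : Submodule ℝ (L2Vec Ω × L2Scal Ω) where
  carrier := {x | IsWeakDiv Ω x.1 x.2}
  zero_mem' := by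
    simp only [Set.mem_ofPred_eq, isWeakDiv_iff]
    intro φ h
    simp
  add_mem' {x y} hx hy := by
    simp only [Set.mem_ofPred_eq, isWeakDiv_iff] at *
    intro φ h
    simp only [Prod.fst_add, Prod.snd_add, inner_add_left, hx φ h, hy φ h]
    ring
  smul_mem' c x hx := by
    simp only [Set.mem_ofPred_eq, isWeakDiv_iff] at *
    intro φ h
    simp only [Prod.smul_fst, Prod.smul_snd, real_inner_smul_left, hx φ h]
    ring

/-- The weak curl as an unbounded operator on `L²(Ω; ℝ³)`; its domain is `H(curl, Ω)`. -/
def weakCurl (Ω : Set R3) : L2Vec Ω →ₗ.[ℝ] L2Vec Ω := (curlGraph Ω).toLinearPMap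

/-- The weak divergence as an unbounded operator from `L²(Ω; ℝ³)` to `L²(Ω)`; its domain is
`H(div, Ω)`. -/
def weakDiv (Ω : Set R3) : L2Vec Ω →ₗ.[ℝ] L2Scal Ω := (divGraph Ω).toLinearPMap

/-- An `L²` function whose pairings with all test functions vanish is zero; hence weak derivatives
are unique and the two operators above have the intended values. -/
theorem eq_zero_of_forall_test {Ω : Set R3} (hΩ : IsOpen Ω) {F : Type} [NormedAddCommGroup F]
    [InnerProductSpace ℝ F] [CompleteSpace F] (w : Lp F 2 (volume.restrict Ω))
    (h : ∀ φ : R3 → F, IsTest Ω φ → ∫ x in Ω, ⟪w x, φ x⟫_ℝ = 0) : w = 0 := by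
  have hloc : LocallyIntegrable w (volume.restrict Ω) :=
    (Lp.memLp w).locallyIntegrable (by norm_num)
  have key := hΩ.ae_eq_zero_of_integral_contDiff_smul_eq_zero (μ := volume.restrict Ω)
    (f := w) (hloc.locallyIntegrableOn Ω) (fun g hg hgc hgs => by
      have hgi : Integrable (fun x => g x • w x) (volume.restrict Ω) :=
        hloc.integrable_smul_left_of_hasCompactSupport hg.continuous hgc
      refine ext_inner_left ℝ fun v => ?_
      rw [← integral_inner hgi v, inner_zero_right]
      have hφ : IsTest Ω (fun x => g x • v) :=
        ⟨hg.smul contDiff_const, hgc.smul_right,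
          (closure_mono (Function.support_smul_subset_left g (fun _ => v))).trans hgs⟩
      rw [← h _ hφ]
      refine integral_congr_ae (ae_of_all _ fun x => ?_)
      simp only [real_inner_smul_right, real_inner_smul_left, real_inner_comm])
  rw [Lp.eq_zero_iff_ae_eq_zero]
  filter_upwards [key, ae_restrict_mem hΩ.measurableSet] with x hx hxm using hx hxm

theorem mem_graph_weakCurl {Ω : Set R3} (hΩ : IsOpen Ω) (x : L2Vec Ω × L2Vec Ω) :
    x ∈ (weakCurl Ω).graph ↔ IsWeakCurl Ω x.1 x.2 := by
  unfold weakCurl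
  rw [Submodule.toLinearPMap_graph_eq]
  · rfl
  · intro y hy h0
    refine eq_zero_of_forall_test hΩ _ fun φ hφ => ?_
    have hy' : IsWeakCurl Ω y.1 y.2 := hy
    rw [← hy' φ hφ, h0, integral_inner_eq 0 (continuous_curl hφ.smooth)
      (hasCompactSupport_curl hφ.compact), inner_zero_left]

theorem mem_graph_weakDiv {Ω : Set R3} (hΩ : IsOpen Ω) (x : L2Vec Ω × L2Scal Ω) :
    x ∈ (weakDiv Ω).graph ↔ IsWeakDiv Ω x.1 x.2 := by
  unfold weakDiv
  rw [Submodule.toLinearPMap_graph_eq]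
  · rfl
  · intro y hy h0
    refine eq_zero_of_forall_test hΩ _ fun φ hφ => ?_
    have hy' := (isWeakDiv_iff y.1 y.2).1 hy φ hφ
    rw [integral_inner_eq _ hφ.smooth.continuous hφ.compact]
    rw [h0, inner_zero_left] at hy'
    linarith

/-! ### The domain complex -/

/-- A choice of the domain complex `V¹ → V² → V³ = L²(Ω)` inside the `L²` de Rham complex of `Ω`:
`d¹` and `d²` are restrictions of the weak curl and of the weak divergence to dense subspaces
`V¹ ⊆ H(curl, Ω)` and `V² ⊆ H(div, Ω)`, they are closed operators and `d¹` maps `V¹` into `V²`.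
The choice of `V¹` and `V²` encodes the essential boundary conditions. -/
structure DeRhamDomain (Ω : Set R3) where
  d1 : L2Vec Ω →ₗ.[ℝ] L2Vec Ω
  d2 : L2Vec Ω →ₗ.[ℝ] L2Scal Ω
  d1_le : d1 ≤ weakCurl Ω
  d2_le : d2 ≤ weakDiv Ω
  dense1 : Dense (d1.domain : Set (L2Vec Ω))
  dense2 : Dense (d2.domain : Set (L2Vec Ω))
  closed1 : d1.IsClosed
  closed2 : d2.IsClosed
  maps_domain : ∀ u : d1.domain, d1 u ∈ d2.domain

/-! ### Domains of unbounded operators with the graph norm -/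

section GraphSpace

variable {E F G : Type} [NormedAddCommGroup E] [NormedSpace ℝ E] [NormedAddCommGroup F]
  [NormedSpace ℝ F] [NormedAddCommGroup G] [NormedSpace ℝ G]

/-- The domain of an unbounded operator `T`, with the norm `‖x‖ + ‖T x‖`. -/
def GraphSpace (T : E →ₗ.[ℝ] F) : Type := T.domain

namespace GraphSpace

variable (T : E →ₗ.[ℝ] F)

instance : AddCommGroup (GraphSpace T) := inferInstanceAs (AddCommGroup T.domain)

instance : Module ℝ (GraphSpace T) := inferInstanceAs (Module ℝ T.domain)

variable {T}

/-- The inclusion of the domain of `T` in the ambient space. -/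
def val : GraphSpace T →ₗ[ℝ] E := T.domain.subtype

/-- The operator `T` on its domain. -/
def op : GraphSpace T →ₗ[ℝ] F := T.toFun

instance : Norm (GraphSpace T) := ⟨fun x => ‖val x‖ + ‖op x‖⟩

theorem norm_def (x : GraphSpace T) : ‖x‖ = ‖val x‖ + ‖op x‖ := rfl

theorem core : NormedSpace.Core ℝ (GraphSpace T) where
  norm_nonneg x := by rw [norm_def]; positivity
  norm_smul c x := by simp only [norm_def, map_smul, norm_smul]; ring
  norm_triangle x y := by
    simp only [norm_def, map_add]
    linarith [norm_add_le (val x) (val y), norm_add_le (op x) (op y)]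
  norm_eq_zero_iff x := by
    constructor
    · intro h
      rw [norm_def] at h
      have h1 : ‖val x‖ = 0 := by linarith [norm_nonneg (val x), norm_nonneg (op x)]
      exact Subtype.ext (norm_eq_zero.1 h1)
    · rintro rfl
      simp [norm_def]

instance : NormedAddCommGroup (GraphSpace T) := NormedAddCommGroup.ofCore core

instance : NormedSpace ℝ (GraphSpace T) := NormedSpace.ofCore core

theorem norm_eq (x : GraphSpace T) : ‖x‖ = ‖val x‖ + ‖op x‖ := rfl

theorem norm_val_le (x : GraphSpace T) : ‖val x‖ ≤ ‖x‖ := by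
  rw [norm_eq]; linarith [norm_nonneg (op x)]

theorem norm_op_le (x : GraphSpace T) : ‖op x‖ ≤ ‖x‖ := by
  rw [norm_eq]; linarith [norm_nonneg (val x)]

end GraphSpace

/-- The operator `x ↦ (S x, T x)` on the intersection of the domains of `S` and `T`; the target
carries the norm `‖y‖ + ‖z‖`. -/
def pairOp (S : E →ₗ.[ℝ] F) (T : E →ₗ.[ℝ] G) : E →ₗ.[ℝ] WithLp 1 (F × G) where
  domain := S.domain ⊓ T.domain
  toFun := (WithLp.linearEquiv 1 ℝ (F × G)).symm.toLinearMap ∘ₗ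
    (S.toFun ∘ₗ Submodule.inclusion inf_le_left).prod
      (T.toFun ∘ₗ Submodule.inclusion inf_le_right)

end GraphSpace

/-! ### The function spaces of the problem -/

namespace DeRhamDomain

variable {Ω : Set R3} (C : DeRhamDomain Ω)

/-- `V¹` with the norm `‖u‖ + ‖d u‖`. -/
abbrev V1 : Type := GraphSpace C.d1

/-- `V²` with the norm `‖u‖ + ‖d u‖`. -/
abbrev V2 : Type := GraphSpace C.d2

/-- The codifferential `d* : V*₂ → W¹`, the Hilbert space adjoint of `(d¹, V¹)`. -/
def dstar2 : L2Vec Ω →ₗ.[ℝ] L2Vec Ω := C.d1.adjoint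

/-- The codifferential `d* : V*₃ → W²`, the Hilbert space adjoint of `(d², V²)`. -/
def dstar3 : L2Scal Ω →ₗ.[ℝ] L2Vec Ω := C.d2.adjoint

/-- The harmonic forms `ℌ³`: as `d` vanishes on `V³ = W³`, they are the orthogonal complement
of `𝔅³ = d V²` in `W³`. -/
def harm3 : Submodule ℝ (L2Scal Ω) := (LinearMap.range C.d2.toFun)ᗮ

/-- `V*₂` with the norm `‖v‖ + ‖d* v‖`. -/
abbrev VStar2 : Type := GraphSpace C.dstar2

/-- `V² ∩ V*₂` with the norm `‖u‖ + ‖d u‖ + ‖d* u‖`. -/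
abbrev VCap2 : Type := GraphSpace (pairOp C.d2 C.dstar2)

variable {C} in
/-- The exterior derivative `d u ∈ W³` of `u ∈ V² ∩ V*₂`. -/
def capD (u : C.VCap2) : L2Scal Ω := (GraphSpace.op u).fst

variable {C} in
/-- The codifferential `d* u ∈ W¹` of `u ∈ V² ∩ V*₂`. -/
def capDstar (u : C.VCap2) : L2Vec Ω := (GraphSpace.op u).snd

/-- `V*₃ ∩ ℌ³ᗮ` with the norm `‖p‖ + ‖d* p‖`. -/
abbrev VStar3 : Submodule ℝ (GraphSpace C.dstar3) := C.harm3ᗮ.comap GraphSpace.val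

/-- The space `(V² ∩ V*₂) × (V*₃ ∩ ℌ³ᗮ)` on which the primal operators act. -/
abbrev PrimalSpace : Type := C.VCap2 × C.VStar3

/-- The space `V*₂ × (W³ ∩ ℌ³ᗮ)`, whose dual is the target of the primal operators. -/
abbrev PrimalTest : Type := C.VStar2 × C.harm3ᗮ

/-! ### The primal operators -/

open GraphSpace (val op)

/-- The bilinear form
`⟨ν d* u, d* v⟩ + ⟨l₃ d* u + l₅ u - d* p, v⟩ + ⟨d u, q⟩`. -/
def primalForm (ν : ℝ) (l3 l5 : L2Vec Ω →L[ℝ] L2Vec Ω) (x : C.PrimalSpace) (y : C.PrimalTest) :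
    ℝ :=
  ⟪ν • capDstar x.1, op y.1⟫_ℝ
    + ⟪l3 (capDstar x.1) + l5 (val x.1) - op (x.2 : GraphSpace C.dstar3), val y.1⟫_ℝ
    + ⟪capD x.1, (y.2 : L2Scal Ω)⟫_ℝ

/-- The bilinear form
`⟨ν d* u + l₃* u, d* v⟩ + ⟨l₅* u + d* p, v⟩ + ⟨-d u, q⟩`. -/
def dualForm (ν : ℝ) (l3 l5 : L2Vec Ω →L[ℝ] L2Vec Ω) (x : C.PrimalSpace) (y : C.PrimalTest) :
    ℝ :=
  ⟪ν • capDstar x.1 + l3.adjoint (val x.1), op y.1⟫_ℝ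
    + ⟪l5.adjoint (val x.1) + op (x.2 : GraphSpace C.dstar3), val y.1⟫_ℝ
    + ⟪-capD x.1, (y.2 : L2Scal Ω)⟫_ℝ

section Bounds

variable {C}

theorem capD_add (u v : C.VCap2) : capD (u + v) = capD u + capD v := by simp [capD]

theorem capD_smul (c : ℝ) (u : C.VCap2) : capD (c • u) = c • capD u := by simp [capD]

theorem capDstar_add (u v : C.VCap2) : capDstar (u + v) = capDstar u + capDstar v := by
  simp [capDstar]

theorem capDstar_smul (c : ℝ) (u : C.VCap2) : capDstar (c • u) = c • capDstar u := by
  simp [capDstar]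

theorem norm_cap (u : C.VCap2) : ‖u‖ = ‖val u‖ + (‖capD u‖ + ‖capDstar u‖) := by
  rw [GraphSpace.norm_eq, WithLp.prod_norm_eq_of_L1]; rfl

theorem norm_val_cap_le (u : C.VCap2) : ‖val u‖ ≤ ‖u‖ := GraphSpace.norm_val_le u

theorem norm_capD_le (u : C.VCap2) : ‖capD u‖ ≤ ‖u‖ := by
  rw [norm_cap]; linarith [norm_nonneg (val u), norm_nonneg (capDstar u)]

theorem norm_capDstar_le (u : C.VCap2) : ‖capDstar u‖ ≤ ‖u‖ := by
  rw [norm_cap]; linarith [norm_nonneg (val u), norm_nonneg (capD u)]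

theorem norm_op_star3_le (p : C.VStar3) : ‖op (p : GraphSpace C.dstar3)‖ ≤ ‖p‖ :=
  GraphSpace.norm_op_le _

theorem abs_inner_le {H : Type} [NormedAddCommGroup H] [InnerProductSpace ℝ H] {a b : H}
    {r s : ℝ} (ha : ‖a‖ ≤ r) (hb : ‖b‖ ≤ s) : |⟪a, b⟫_ℝ| ≤ r * s :=
  (abs_real_inner_le_norm a b).trans
    (mul_le_mul ha hb (norm_nonneg _) ((norm_nonneg _).trans ha))

theorem abs_primalForm_le (ν : ℝ) (l3 l5 : L2Vec Ω →L[ℝ] L2Vec Ω) (x : C.PrimalSpace)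
    (y : C.PrimalTest) :
    ‖C.primalForm ν l3 l5 x y‖ ≤ (|ν| + ‖l3‖ + ‖l5‖ + 2) * ‖x‖ * ‖y‖ := by
  have hu : ‖x.1‖ ≤ ‖x‖ := norm_fst_le x
  have hp : ‖x.2‖ ≤ ‖x‖ := norm_snd_le x
  have hv : ‖y.1‖ ≤ ‖y‖ := norm_fst_le y
  have hq : ‖(y.2 : L2Scal Ω)‖ ≤ ‖y‖ := norm_snd_le y
  have e1 : ‖ν • capDstar x.1‖ ≤ |ν| * ‖x‖ := by
    rw [norm_smul, Real.norm_eq_abs]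
    exact mul_le_mul_of_nonneg_left ((norm_capDstar_le _).trans hu) (abs_nonneg _)
  have e2 : ‖l3 (capDstar x.1) + l5 (val x.1) - op (x.2 : GraphSpace C.dstar3)‖
      ≤ ‖l3‖ * ‖x‖ + ‖l5‖ * ‖x‖ + ‖x‖ := by
    refine (norm_sub_le _ _).trans (add_le_add ((norm_add_le _ _).trans (add_le_add ?_ ?_)) ?_)
    · exact l3.le_opNorm_of_le ((norm_capDstar_le _).trans hu)
    · exact l5.le_opNorm_of_le ((norm_val_cap_le _).trans hu)
    · exact (norm_op_star3_le _).trans hp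
  have i1 := abs_inner_le e1 ((GraphSpace.norm_op_le y.1).trans hv)
  have i2 := abs_inner_le e2 ((GraphSpace.norm_val_le y.1).trans hv)
  have i3 := abs_inner_le ((norm_capD_le x.1).trans hu) hq
  rw [Real.norm_eq_abs, primalForm]
  refine (abs_add_three _ _ _).trans ((add_le_add (add_le_add i1 i2) i3).trans (le_of_eq ?_))
  ring

theorem abs_dualForm_le (ν : ℝ) (l3 l5 : L2Vec Ω →L[ℝ] L2Vec Ω) (x : C.PrimalSpace)
    (y : C.PrimalTest) :
    ‖C.dualForm ν l3 l5 x y‖ ≤ (|ν| + ‖l3.adjoint‖ + ‖l5.adjoint‖ + 2) * ‖x‖ * ‖y‖ := by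
  have hu : ‖x.1‖ ≤ ‖x‖ := norm_fst_le x
  have hp : ‖x.2‖ ≤ ‖x‖ := norm_snd_le x
  have hv : ‖y.1‖ ≤ ‖y‖ := norm_fst_le y
  have hq : ‖(y.2 : L2Scal Ω)‖ ≤ ‖y‖ := norm_snd_le y
  have e1 : ‖ν • capDstar x.1 + l3.adjoint (val x.1)‖ ≤ |ν| * ‖x‖ + ‖l3.adjoint‖ * ‖x‖ := by
    refine (norm_add_le _ _).trans (add_le_add ?_ ?_)
    · rw [norm_smul, Real.norm_eq_abs]
      exact mul_le_mul_of_nonneg_left ((norm_capDstar_le _).trans hu) (abs_nonneg _)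
    · exact l3.adjoint.le_opNorm_of_le ((norm_val_cap_le _).trans hu)
  have e2 : ‖l5.adjoint (val x.1) + op (x.2 : GraphSpace C.dstar3)‖
      ≤ ‖l5.adjoint‖ * ‖x‖ + ‖x‖ := by
    refine (norm_add_le _ _).trans (add_le_add ?_ ?_)
    · exact l5.adjoint.le_opNorm_of_le ((norm_val_cap_le _).trans hu)
    · exact (norm_op_star3_le _).trans hp
  have i1 := abs_inner_le e1 ((GraphSpace.norm_op_le y.1).trans hv)
  have i2 := abs_inner_le e2 ((GraphSpace.norm_val_le y.1).trans hv)
  have e3 : ‖-capD x.1‖ ≤ ‖x‖ := by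
    rw [norm_neg]
    exact (norm_capD_le x.1).trans hu
  have i3 := abs_inner_le e3 hq
  rw [Real.norm_eq_abs, dualForm]
  refine (abs_add_three _ _ _).trans ((add_le_add (add_le_add i1 i2) i3).trans (le_of_eq ?_))
  ring

end Bounds

/-- The primal operator `L̄₁ : (V² ∩ V*₂) × (V*₃ ∩ ℌ³ᗮ) → (V*₂ × (W³ ∩ ℌ³ᗮ))'`. -/
def primalOp (ν : ℝ) (l3 l5 : L2Vec Ω →L[ℝ] L2Vec Ω) :
    C.PrimalSpace →L[ℝ] StrongDual ℝ C.PrimalTest :=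
  (LinearMap.mk₂ ℝ (C.primalForm ν l3 l5)
    (fun x x' y => by
      simp only [primalForm, Prod.fst_add, Prod.snd_add, Submodule.coe_add, capD_add,
        capDstar_add, map_add, smul_add, inner_add_left, inner_sub_left]
      ring)
    (fun c x y => by
      simp only [primalForm, Prod.smul_fst, Prod.smul_snd, Submodule.coe_smul, capD_smul,
        capDstar_smul, map_smul, real_inner_smul_left, inner_add_left, inner_sub_left, smul_eq_mul]
      ring)
    (fun x y y' => by
      simp only [primalForm, Prod.fst_add, Prod.snd_add, Submodule.coe_add, map_add,
        inner_add_right]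
      ring)
    (fun c x y => by
      simp only [primalForm, Prod.smul_fst, Prod.smul_snd, Submodule.coe_smul, map_smul,
        real_inner_smul_right, smul_eq_mul]
      ring)).mkContinuous₂ _ (C.abs_primalForm_le ν l3 l5)

/-- The dual operator `L̄₁' : (V² ∩ V*₂) × (V*₃ ∩ ℌ³ᗮ) → (V*₂ × (W³ ∩ ℌ³ᗮ))'`. -/
def dualOp (ν : ℝ) (l3 l5 : L2Vec Ω →L[ℝ] L2Vec Ω) :
    C.PrimalSpace →L[ℝ] StrongDual ℝ C.PrimalTest :=
  (LinearMap.mk₂ ℝ (C.dualForm ν l3 l5)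
    (fun x x' y => by
      simp only [dualForm, Prod.fst_add, Prod.snd_add, Submodule.coe_add, capD_add,
        capDstar_add, map_add, smul_add, inner_add_left, inner_neg_left]
      ring)
    (fun c x y => by
      simp only [dualForm, Prod.smul_fst, Prod.smul_snd, Submodule.coe_smul, capD_smul,
        capDstar_smul, map_smul, real_inner_smul_left, inner_add_left, inner_neg_left, smul_eq_mul]
      ring)
    (fun x y y' => by
      simp only [dualForm, Prod.fst_add, Prod.snd_add, Submodule.coe_add, map_add,
        inner_add_right]
      ring)
    (fun c x y => by
      simp only [dualForm, Prod.smul_fst, Prod.smul_snd, Submodule.coe_smul, map_smul,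
        real_inner_smul_right, smul_eq_mul]
      ring)).mkContinuous₂ _ (C.abs_dualForm_le ν l3 l5)

/-- `f = (f₂, f₃) ∈ W = W² × (W³ ∩ ℌ³ᗮ)` as the functional `(v, q) ↦ ⟨f₂, v⟩ + ⟨f₃, q⟩` on
`V*₂ × (W³ ∩ ℌ³ᗮ)`. -/
def dataFunctional (f2 : L2Vec Ω) (f3 : C.harm3ᗮ) : StrongDual ℝ C.PrimalTest :=
  LinearMap.mkContinuous
    { toFun := fun y => ⟪f2, val y.1⟫_ℝ + ⟪(f3 : L2Scal Ω), (y.2 : L2Scal Ω)⟫_ℝ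
      map_add' := fun y y' => by
        simp only [Prod.fst_add, Prod.snd_add, Submodule.coe_add, map_add, inner_add_right]
        ring
      map_smul' := fun c y => by
        simp only [Prod.smul_fst, Prod.smul_snd, Submodule.coe_smul, map_smul,
          real_inner_smul_right, smul_eq_mul, RingHom.id_apply]
        ring }
    (‖f2‖ + ‖f3‖) (fun y => by
      have i1 := abs_inner_le (le_refl ‖f2‖) ((GraphSpace.norm_val_le y.1).trans (norm_fst_le y))
      have i2 := abs_inner_le (le_refl ‖(f3 : L2Scal Ω)‖)
        (show ‖(y.2 : L2Scal Ω)‖ ≤ ‖y‖ from norm_snd_le y)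
      refine (abs_add_le _ _).trans ((add_le_add i1 i2).trans (le_of_eq ?_))
      rw [add_mul]; rfl)

/-- The regularity assumption
`d* (L̄₁⁻¹)₂ (W) ⊆ V¹` and `(ν d* + l₃*) (K)₂ (W) ⊆ V¹`, with `K = (L̄₁')⁻¹`. -/
def Regularity (ν : ℝ) (l3 l5 : L2Vec Ω →L[ℝ] L2Vec Ω) : Prop :=
  (∀ (f2 : L2Vec Ω) (f3 : C.harm3ᗮ),
    capDstar ((C.primalOp ν l3 l5).inverse (C.dataFunctional f2 f3)).1 ∈ C.d1.domain) ∧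
  ∀ (f2 : L2Vec Ω) (f3 : C.harm3ᗮ),
    ν • capDstar ((C.dualOp ν l3 l5).inverse (C.dataFunctional f2 f3)).1
      + l3.adjoint (val ((C.dualOp ν l3 l5).inverse (C.dataFunctional f2 f3)).1) ∈ C.d1.domain

/-! ### The mixed problem -/

/-- `V = V¹ × V² × V³ × ℌ³`, with `V³ = W³ = L²(Ω)`. -/
abbrev MixedSpace : Type := C.V1 × C.V2 × L2Scal Ω × C.harm3

/-- The norm `‖u₁‖_V + ‖u₂‖_V + ‖u₃‖_V + ‖u_p‖_V` on `V`; here `‖·‖_V = ‖·‖` on `V³` and on `ℌ³`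
because `d = 0` on `V³`. -/
def normV (u : C.MixedSpace) : ℝ := ‖u.1‖ + ‖u.2.1‖ + ‖u.2.2.1‖ + ‖u.2.2.2‖

/-- The bilinear form `B` of the mixed problem. -/
def mixedForm (ν : ℝ) (l3 l5 : L2Vec Ω →L[ℝ] L2Vec Ω) : C.MixedSpace → C.MixedSpace → ℝ
  | (u1, u2, u3, up), (v1, v2, v3, vp) =>
    ⟪val u1, val v1⟫_ℝ - ⟪val u2, op v1⟫_ℝ
      + ν * ⟪op u1, val v2⟫_ℝ - ⟪u3, op v2⟫_ℝ + ⟪op u2, v3⟫_ℝ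
      + ⟪l3 (val u1), val v2⟫_ℝ + ⟪l5 (val u2), val v2⟫_ℝ
      + ⟪(up : L2Scal Ω), v3⟫_ℝ + ⟪u3, (vp : L2Scal Ω)⟫_ℝ

/-- `u ∈ V` solves `B(u, v) = R(v)` for all `v ∈ V`. -/
def IsMixedSolution (ν : ℝ) (l3 l5 : L2Vec Ω →L[ℝ] L2Vec Ω) (R : C.MixedSpace → ℝ)
    (u : C.MixedSpace) : Prop :=
  ∀ v : C.MixedSpace, C.mixedForm ν l3 l5 u v = R v

/-- The right-hand side `v ↦ ⟨f₂, v₂⟩ + ⟨f₃, v₃⟩` of the mixed problem. -/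
def mixedData (f2 : L2Vec Ω) (f3 : L2Scal Ω) (v : C.MixedSpace) : ℝ :=
  ⟪f2, val v.2.1⟫_ℝ + ⟪f3, v.2.2.1⟫_ℝ

end DeRhamDomain

end VorticityMixed

end

/-! Testing `B(u, v)` one component at a time decouples the mixed problem. The `v₁` row says that
`u₂` lies in `V*₂` with `u₁ = d* u₂`. The `v_p` row says `u₃ ⊥ ℌ³`. The `v₃` row says `d u₂ + u_p =
f₃`, so `u_p` is the harmonic part of `f₃`. The `v₂` row says `u₃ ∈ V*₃` with `ν d u₁ + l₃ u₁ + l₅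
u₂ - d* u₃ = f₂`. Hence a mixed solution is a primal pair `(u₂, u₃)` for which `d* u₂` happens to
lie in `V¹`.

Existence for square integrable data (`exists_solution_of_data`): invert the primal operator.
Regularity puts `d* u₂` in `V¹`, and density of `V*₂` (a consequence of `d¹` being closed,
`dense_domain_adjoint`) upgrades the primal equation to a strong one (`strong_of_primalOp_eq`), from
which the bound on `d u₁` is read off. Uniqueness (`eq_zero_of_mixedForm_eq_zero`): a homogeneous
mixed solution gives a kernel element of the primal operator.

A general functional is reduced to square integrable data (`exists_solution_of_functional`). By
Riesz its non-`L²` parts are `⟨da, dv₁⟩` and `⟨db, dv₂⟩`. These are produced by the explicit shift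
`u₂ = -da`, `u₃ = -db`, where `-da` is admissible because `da ∈ V²` and `d(da) = 0`. -/

namespace VorticityMixed

/-! ### Closed densely defined operators between Hilbert spaces -/

section HilbertOperators

variable {E F : Type} [NormedAddCommGroup E] [InnerProductSpace ℝ E] [NormedAddCommGroup F]
  [InnerProductSpace ℝ F]

/-- The graph of `T` as a subspace of the Hilbert sum of `E` and `F`. -/
def hilbertGraph (T : E →ₗ.[ℝ] F) : Submodule ℝ (WithLp 2 (E × F)) :=
  T.graph.comap (WithLp.linearEquiv 2 ℝ (E × F)).toLinearMap

theorem mem_hilbertGraph {T : E →ₗ.[ℝ] F} {x : WithLp 2 (E × F)} :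
    x ∈ hilbertGraph T ↔ (x.fst, x.snd) ∈ T.graph := Iff.rfl

theorem isClosed_hilbertGraph {T : E →ₗ.[ℝ] F} (hc : T.IsClosed) :
    IsClosed (hilbertGraph T : Set (WithLp 2 (E × F))) :=
  IsClosed.preimage (WithLp.prod_continuous_ofLp 2 E F) hc

variable [CompleteSpace E]

/-- Von Neumann's argument: the second components of vectors orthogonal to the graph lie in the
domain of the adjoint. So if `y` is orthogonal to that domain, `(0, y)` lies in the double
orthogonal complement of the graph, which is the graph itself by closedness, and `y = T 0 = 0`. -/
theorem dense_domain_adjoint [CompleteSpace F] {T : E →ₗ.[ℝ] F} (hc : T.IsClosed) :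
    Dense (T.adjoint.domain : Set F) := by
  rw [Submodule.dense_iff_topologicalClosure_eq_top, Submodule.topologicalClosure_eq_top_iff,
    Submodule.eq_bot_iff]
  intro y hy
  have : CompleteSpace (hilbertGraph T) := (isClosed_hilbertGraph hc).completeSpace_coe
  have hmem : WithLp.toLp 2 ((0 : E), y) ∈ hilbertGraph T := by
    rw [← Submodule.orthogonal_orthogonal (hilbertGraph T), Submodule.mem_orthogonal]
    intro z hz
    have hz' : z.snd ∈ T.adjoint.domain := by
      refine LinearPMap.mem_adjoint_domain_of_exists _ ⟨-z.fst, fun x => ?_⟩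
      have h := (Submodule.mem_orthogonal _ _).1 hz (WithLp.toLp 2 ((x : E), T x))
        (mem_hilbertGraph.2 (T.mem_graph x))
      rw [WithLp.prod_inner_apply] at h
      rw [inner_neg_left, real_inner_comm, real_inner_comm (T x)]
      exact neg_eq_of_add_eq_zero_right h
    rw [WithLp.prod_inner_apply]
    simpa using (Submodule.mem_orthogonal _ _).1 hy _ hz'
  obtain ⟨x, hx0, hxy⟩ := (LinearPMap.mem_graph_iff T).1 (mem_hilbertGraph.1 hmem)
  have hx : x = 0 := Subtype.ext hx0
  rw [hx, LinearPMap.map_zero] at hxy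
  exact hxy.symm

namespace GraphSpace

/-- Riesz representation on the domain of a closed operator. -/
theorem exists_riesz [CompleteSpace F] {T : E →ₗ.[ℝ] F} (hc : T.IsClosed)
    (f : GraphSpace T →ₗ[ℝ] ℝ) {M : ℝ} (hM : 0 ≤ M) (hf : ∀ v, |f v| ≤ M * ‖v‖) :
    ∃ a : GraphSpace T, (∀ v, f v = ⟪val a, val v⟫_ℝ + ⟪op a, op v⟫_ℝ) ∧ ‖a‖ ≤ 4 * M := by
  have : CompleteSpace (hilbertGraph T) := (isClosed_hilbertGraph hc).completeSpace_coe
  -- The sum norm on the domain is not Hilbertian, so Riesz is applied on the closed graph in the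
  -- Hilbert sum. Passing there and back costs a factor 2 each way, whence the 4.
  let e₀ : GraphSpace T →ₗ[ℝ] hilbertGraph T :=
    { toFun := fun x => ⟨WithLp.toLp 2 (val x, op x), mem_hilbertGraph.2 (T.mem_graph x)⟩
      map_add' := fun x y => by ext1; simp [← WithLp.toLp_add]
      map_smul' := fun c x => by ext1; simp [← WithLp.toLp_smul] }
  have he₀ : Function.Bijective e₀ := by
    constructor
    · intro x y h
      exact Subtype.ext (congrArg (fun z : hilbertGraph T => (z : WithLp 2 (E × F)).fst) h)
    · rintro ⟨z, hz⟩
      obtain ⟨x, hx1, hx2⟩ := (LinearPMap.mem_graph_iff T).1 (mem_hilbertGraph.1 hz)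
      exact ⟨x, Subtype.ext (WithLp.ofLp_injective 2 (Prod.ext hx1 hx2))⟩
  let e := LinearEquiv.ofBijective e₀ he₀
  have hfst : ∀ x, ((e x : WithLp 2 (E × F))).fst = val x := fun x => rfl
  have hsnd : ∀ x, ((e x : WithLp 2 (E × F))).snd = op x := fun x => rfl
  have hnorm : ∀ x, ‖x‖ ≤ 2 * ‖e x‖ := by
    intro x
    rw [norm_eq, ← hfst, ← hsnd]
    have h1 := WithLp.norm_fst_le (p := 2) E (e x : WithLp 2 (E × F))
    have h2 := WithLp.norm_snd_le (p := 2) E (e x : WithLp 2 (E × F))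
    rw [Submodule.coe_norm]
    linarith
  let g : StrongDual ℝ (hilbertGraph T) :=
    (f ∘ₗ e.symm.toLinearMap).mkContinuous (2 * M) (fun z => by
      have h := hnorm (e.symm z)
      rw [e.apply_symm_apply] at h
      calc ‖f (e.symm z)‖ ≤ M * ‖e.symm z‖ := hf _
        _ ≤ M * (2 * ‖z‖) := mul_le_mul_of_nonneg_left h hM
        _ = 2 * M * ‖z‖ := by ring)
  have hg : ‖g‖ ≤ 2 * M := LinearMap.mkContinuous_norm_le _ (by positivity) _
  refine ⟨e.symm ((InnerProductSpace.toDual ℝ _).symm g), fun v => ?_, ?_⟩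
  · have h := InnerProductSpace.toDual_symm_apply (𝕜 := ℝ) (x := e v) (y := g)
    rw [Submodule.coe_inner, WithLp.prod_inner_apply] at h
    have h1 : g (e v) = f v := congrArg f (e.symm_apply_apply v)
    rw [← h1, ← h, ← hfst, ← hsnd, e.apply_symm_apply]
    rfl
  · refine (hnorm _).trans ?_
    rw [e.apply_symm_apply, LinearIsometryEquiv.norm_map]
    linarith

end GraphSpace

end HilbertOperators

/-! ### The complex property `div curl = 0` -/

theorem gradient_apply (φ : R3 → ℝ) (x : R3) (j : Fin 3) :
    gradient φ x j = fderiv ℝ φ x (EuclideanSpace.single j 1) := by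
  have h : ⟪gradient φ x, EuclideanSpace.single j (1 : ℝ)⟫_ℝ =
      fderiv ℝ φ x (EuclideanSpace.single j 1) := InnerProductSpace.toDual_symm_apply
  rw [← h, EuclideanSpace.inner_single_right]
  simp

theorem contDiff_gradient {φ : R3 → ℝ} (h : ContDiff ℝ ∞ φ) : ContDiff ℝ ∞ (gradient φ) := by
  rw [contDiff_euclidean]
  intro j
  simp only [gradient_apply]
  exact (h.fderiv_right (m := ∞) (by simp)).clm_apply contDiff_const

theorem IsTest.gradient {Ω : Set R3} {φ : R3 → ℝ} (h : IsTest Ω φ) : IsTest Ω (gradient φ) := by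
  refine ⟨contDiff_gradient h.smooth, hasCompactSupport_gradient h.compact, ?_⟩
  refine (closure_minimal ?_ (isClosed_tsupport _)).trans ((tsupport_fderiv_subset ℝ).trans h.supp)
  intro x hx
  refine subset_tsupport _ fun h0 => hx ?_
  have : fderiv ℝ φ x = 0 := h0
  simp [_root_.gradient, this]

theorem partialD_gradient {φ : R3 → ℝ} (h : ContDiff ℝ ∞ φ) (i j : Fin 3) (x : R3) :
    partialD (gradient φ) i j x =
      fderiv ℝ (fderiv ℝ φ) x (EuclideanSpace.single i 1) (EuclideanSpace.single j 1) := by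
  have hg : DifferentiableAt ℝ (gradient φ) x :=
    (contDiff_gradient h).differentiable (by simp) x
  have hf : DifferentiableAt ℝ (fderiv ℝ φ) x :=
    (h.fderiv_right (m := ∞) (by simp)).differentiable (by simp) x
  have h1 : HasFDerivAt (fun y => gradient φ y j)
      ((EuclideanSpace.proj (𝕜 := ℝ) j).comp (fderiv ℝ (gradient φ) x)) x :=
    (EuclideanSpace.proj j : R3 →L[ℝ] ℝ).hasFDerivAt.comp x hg.hasFDerivAt
  simp only [gradient_apply] at h1
  have h2 := hf.hasFDerivAt.clm_apply
    (hasFDerivAt_const (EuclideanSpace.single j (1 : ℝ) : R3) x)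
  have h3 := congrArg (fun L : R3 →L[ℝ] ℝ => L (EuclideanSpace.single i 1)) (h1.unique h2)
  simpa [partialD] using h3

/-- Each component is a difference of mixed second derivatives, which cancel by symmetry. -/
theorem curl_gradient {φ : R3 → ℝ} (h : ContDiff ℝ ∞ φ) (x : R3) : curl (gradient φ) x = 0 := by
  have hs : IsSymmSndFDerivAt ℝ φ x := h.contDiffAt.isSymmSndFDerivAt
    (by simpa using WithTop.coe_le_coe.2 (le_top : (2 : ℕ∞) ≤ ⊤))
  have hp : ∀ i j, partialD (gradient φ) i j x = partialD (gradient φ) j i x := fun i j => by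
    rw [partialD_gradient h, partialD_gradient h]
    exact hs _ _
  ext i
  fin_cases i <;> simp [curl, hp 2 1, hp 2 0, hp 1 0]

/-- The gradient of a scalar test function is an admissible test field for the weak curl, and its
curl vanishes. -/
theorem isWeakDiv_zero_of_isWeakCurl {Ω : Set R3} {u w : L2Vec Ω} (h : IsWeakCurl Ω u w) :
    IsWeakDiv Ω w 0 := by
  refine (isWeakDiv_iff w 0).2 fun φ hφ => ?_
  rw [inner_zero_left, neg_zero, ← integral_inner_eq w hφ.gradient.smooth.continuous
    hφ.gradient.compact, ← h _ hφ.gradient]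
  simp [curl_gradient hφ.smooth]

namespace DeRhamDomain

open GraphSpace (val op)

variable {Ω : Set R3} {C : DeRhamDomain Ω}

/-- Both `0` and `op w` are weak divergences of `op u`, and weak divergences on an open set are
unique. -/
theorem op_op_eq_zero (hΩ : IsOpen Ω) (u : C.V1) (w : C.V2) (hw : val w = op u) : op w = 0 := by
  have h1 : IsWeakCurl Ω (val u) (op u) :=
    (mem_graph_weakCurl hΩ _).1 (LinearPMap.le_graph_of_le C.d1_le (C.d1.mem_graph u))
  have h2 : IsWeakDiv Ω (op u) (op w) := hw ▸
    (mem_graph_weakDiv hΩ _).1 (LinearPMap.le_graph_of_le C.d2_le (C.d2.mem_graph w))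
  exact (weakDiv Ω).mem_graph_snd_inj' ((mem_graph_weakDiv hΩ (_, _)).2 h2)
    ((mem_graph_weakDiv hΩ (_, _)).2 (isWeakDiv_zero_of_isWeakCurl h1)) rfl

end DeRhamDomain

/-! ### Riesz representation and inverse bounds with explicit constants -/

theorem exists_riesz_hilbert {E : Type} [NormedAddCommGroup E] [InnerProductSpace ℝ E]
    [CompleteSpace E] (f : E →ₗ[ℝ] ℝ) {M : ℝ} (hM : 0 ≤ M) (hf : ∀ v, |f v| ≤ M * ‖v‖) :
    ∃ a : E, (∀ v, f v = ⟪a, v⟫_ℝ) ∧ ‖a‖ ≤ M := by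
  refine ⟨(InnerProductSpace.toDual ℝ E).symm (f.mkContinuous M hf), fun v => ?_, ?_⟩
  · rw [InnerProductSpace.toDual_symm_apply]
    rfl
  · rw [LinearIsometryEquiv.norm_map]
    exact LinearMap.mkContinuous_norm_le _ hM _

/-- `inverse` is a continuous linear map in every case (zero when `f` is not invertible), so its
operator norm serves as `K`. -/
theorem exists_bound_inverse {X Y : Type} [NormedAddCommGroup X] [NormedSpace ℝ X]
    [NormedAddCommGroup Y] [NormedSpace ℝ Y] (f : X →L[ℝ] StrongDual ℝ Y) :
    ∃ K : ℝ, 0 ≤ K ∧ ∀ (g : StrongDual ℝ Y) (M : ℝ), 0 ≤ M → (∀ y, ‖g y‖ ≤ M * ‖y‖) →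
      ‖f.inverse g‖ ≤ K * M :=
  ⟨‖f.inverse‖, f.inverse.opNorm_nonneg, fun g _ hM hg =>
    f.inverse.le_opNorm_of_le (g.opNorm_le_bound hM hg)⟩

namespace DeRhamDomain

open GraphSpace (val op)

variable {Ω : Set R3} {C : DeRhamDomain Ω}

/-! ### Adjointness and harmonic forms -/

theorem dense_domain_dstar2 : Dense (C.dstar2.domain : Set (L2Vec Ω)) :=
  dense_domain_adjoint C.closed1

theorem inner_dstar2 (y : C.VStar2) (v : C.V1) : ⟪op y, val v⟫_ℝ = ⟪val y, op v⟫_ℝ :=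
  LinearPMap.adjoint_isFormalAdjoint C.dense1 y v

theorem inner_dstar3 (p : GraphSpace C.dstar3) (v : C.V2) : ⟪op p, val v⟫_ℝ = ⟪val p, op v⟫_ℝ :=
  LinearPMap.adjoint_isFormalAdjoint C.dense2 p v

/-- Turns a weak identity into membership in the adjoint domain; density of `V¹` makes the adjoint's
value unique, hence equal to `w`. -/
theorem exists_vStar2 {x w : L2Vec Ω} (h : ∀ v : C.V1, ⟪w, val v⟫_ℝ = ⟪x, op v⟫_ℝ) :
    ∃ y : C.VStar2, val y = x ∧ op y = w :=
  ⟨⟨x, LinearPMap.mem_adjoint_domain_of_exists _ ⟨w, h⟩⟩, rfl,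
    LinearPMap.adjoint_apply_eq C.dense1 _ h⟩

theorem exists_vStar3 {x : L2Scal Ω} {w : L2Vec Ω}
    (h : ∀ v : C.V2, ⟪w, val v⟫_ℝ = ⟪x, op v⟫_ℝ) :
    ∃ y : GraphSpace C.dstar3, val y = x ∧ op y = w :=
  ⟨⟨x, LinearPMap.mem_adjoint_domain_of_exists _ ⟨w, h⟩⟩, rfl,
    LinearPMap.adjoint_apply_eq C.dense2 _ h⟩

/-- The element of `V² ∩ V*₂` given by a common element of `V²` and `V*₂`. -/
theorem exists_vCap2 (u : C.V2) (y : C.VStar2) (h : val u = val y) :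
    ∃ x : C.VCap2, val x = val u ∧ capD x = op u ∧ capDstar x = op y := by
  obtain ⟨u, hu⟩ := u
  obtain ⟨y, hy⟩ := y
  obtain rfl : u = y := h
  exact ⟨⟨u, hu, hy⟩, rfl, rfl, rfl⟩

theorem inner_harm3_op (h : C.harm3) (v : C.V2) : ⟪(h : L2Scal Ω), op v⟫_ℝ = 0 :=
  (Submodule.mem_orthogonal' _ _).1 h.2 _ (LinearMap.mem_range_self _ v)

theorem op_mem_harm3_orthogonal (v : C.V2) : op v ∈ C.harm3ᗮ :=
  (Submodule.mem_orthogonal _ _).2 fun h hh => inner_harm3_op ⟨h, hh⟩ v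

theorem inner_harm3_orthogonal (h : C.harm3) (q : C.harm3ᗮ) :
    ⟪(q : L2Scal Ω), (h : L2Scal Ω)⟫_ℝ = 0 :=
  (Submodule.mem_orthogonal' _ _).1 q.2 _ h.2

/-- `ℌ³` is itself an orthogonal complement, hence closed, so the projections exist without assuming
that `d V²` is closed. -/
theorem exists_harm3_decomposition (f : L2Scal Ω) :
    ∃ (h : C.harm3) (q : C.harm3ᗮ), f = h + q ∧ ‖h‖ ≤ ‖f‖ ∧ ‖q‖ ≤ ‖f‖ := by
  have : CompleteSpace C.harm3 := (Submodule.isClosed_orthogonal _).completeSpace_coe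
  exact ⟨C.harm3.orthogonalProjectionOnto f, C.harm3ᗮ.orthogonalProjectionOnto f,
    (C.harm3.starProjection_add_starProjection_orthogonal f).symm,
    Submodule.norm_orthogonalProjectionOnto_apply_le _ _,
    Submodule.norm_orthogonalProjectionOnto_apply_le _ _⟩

/-! ### Solving for square integrable data -/

variable {ν : ℝ} {l3 l5 : L2Vec Ω →L[ℝ] L2Vec Ω}

/-- The primal equation, when `d* u ∈ V¹`, holds strongly. -/
theorem strong_of_primalOp_eq {x : C.PrimalSpace} {f2 : L2Vec Ω} {f3 : C.harm3ᗮ}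
    (hx : C.primalOp ν l3 l5 x = C.dataFunctional f2 f3) (u1 : C.V1) (h1 : val u1 = capDstar x.1) :
    ν • op u1 + l3 (val u1) + l5 (val x.1) - op (x.2 : GraphSpace C.dstar3) = f2 ∧
      capD x.1 = f3 := by
  have hform : ∀ y : C.PrimalTest, C.primalForm ν l3 l5 x y =
      ⟪f2, val y.1⟫_ℝ + ⟪(f3 : L2Scal Ω), (y.2 : L2Scal Ω)⟫_ℝ :=
    fun y => congrArg (fun L : StrongDual ℝ C.PrimalTest => L y) hx
  constructor
  · refine (dense_domain_dstar2 (C := C)).eq_of_inner_left ℝ fun v hv => ?_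
    let y : C.VStar2 := ⟨v, hv⟩
    have hy : val y = v := rfl
    have h := hform (y, 0)
    -- Since `d* u ∈ V¹`, adjointness moves `d*` off the test function: `⟨d* u, d* v⟩ = ⟨d d* u,
    -- v⟩`.
    have hadj := inner_dstar2 y u1
    rw [h1, real_inner_comm, real_inner_comm (op u1)] at hadj
    simp only [primalForm, Submodule.coe_zero, inner_zero_right, add_zero, hy, inner_add_left,
      inner_sub_left, real_inner_smul_left] at h
    simp only [inner_add_left, inner_sub_left, real_inner_smul_left, h1, ← h, hadj, hy]
    ring
  · let u2 : C.V2 := ⟨val x.1, x.1.2.1⟩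
    -- The residual lies in the test space, so it can be tested against itself.
    have hq : capD x.1 - f3 ∈ C.harm3ᗮ := sub_mem (op_mem_harm3_orthogonal u2) f3.2
    have h := hform (0, ⟨_, hq⟩)
    simp only [primalForm, map_zero, inner_zero_right, zero_add] at h
    rw [← sub_eq_zero, ← inner_sub_left, inner_self_eq_zero, sub_eq_zero] at h
    exact h

theorem exists_solution_of_data (hν : 0 < ν) (hL : (C.primalOp ν l3 l5).IsInvertible)
    (hreg : ∀ (f2 : L2Vec Ω) (f3 : C.harm3ᗮ),
      capDstar ((C.primalOp ν l3 l5).inverse (C.dataFunctional f2 f3)).1 ∈ C.d1.domain) :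
    ∃ c : ℝ, 0 < c ∧ ∀ (f2 : L2Vec Ω) (f3 : L2Scal Ω), ∃ u : C.MixedSpace,
      C.IsMixedSolution ν l3 l5 (C.mixedData f2 f3) u ∧ C.normV u ≤ c * (‖f2‖ + ‖f3‖) := by
  obtain ⟨K, hK0, hK⟩ := exists_bound_inverse (C.primalOp ν l3 l5)
  -- `3 * K` pays for `u₁` in `L²`, `u₂` and `u₃`; the `ν⁻¹` term for `d u₁`, solved from the strong
  -- equation; the final `1` for `u_p`.
  refine ⟨3 * K + ν⁻¹ * (1 + (‖l3‖ + ‖l5‖ + 1) * K) + 1, by positivity, fun f2 f3 => ?_⟩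
  -- Only the part of `f₃` orthogonal to `ℌ³` can be matched by `d u₂`; the harmonic part becomes
  -- `u_p`.
  obtain ⟨up, q, hf3, hup, hq⟩ := C.exists_harm3_decomposition f3
  set s : ℝ := ‖f2‖ + ‖f3‖ with hs
  obtain ⟨x, hx⟩ : ∃ x, x = (C.primalOp ν l3 l5).inverse (C.dataFunctional f2 q) := ⟨_, rfl⟩
  have hLx : C.primalOp ν l3 l5 x = C.dataFunctional f2 q := by rw [hx, hL.self_apply_inverse]
  have hxs : ‖x‖ ≤ K * s := by
    rw [hx]
    refine hK _ _ (by positivity) fun y => ?_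
    have i1 := abs_inner_le (le_refl ‖f2‖) ((GraphSpace.norm_val_le y.1).trans (norm_fst_le y))
    have i2 := abs_inner_le (show ‖(q : L2Scal Ω)‖ ≤ ‖f3‖ from hq)
      (show ‖(y.2 : L2Scal Ω)‖ ≤ ‖y‖ from norm_snd_le y)
    exact (abs_add_le _ _).trans ((add_le_add i1 i2).trans (add_mul _ _ _).ge)
  have hd := hreg f2 q
  rw [← hx] at hd
  let u1 : C.V1 := ⟨capDstar x.1, hd⟩
  let u2 : C.V2 := ⟨val x.1, x.1.2.1⟩
  let y : C.VStar2 := ⟨val x.1, x.1.2.2⟩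
  have h1 : val u1 = capDstar x.1 := rfl
  have h2 : val u2 = val x.1 := rfl
  have h2d : op u2 = capD x.1 := rfl
  obtain ⟨e2, e3⟩ := strong_of_primalOp_eq hLx u1 h1
  have hx1 : ‖x.1‖ ≤ K * s := (norm_fst_le x).trans hxs
  have hx2 : ‖x.2‖ ≤ K * s := (norm_snd_le x).trans hxs
  refine ⟨(u1, u2, val (x.2 : GraphSpace C.dstar3), up), ?_, ?_⟩
  · rintro ⟨v1, v2, v3, vp⟩
    have a1 : ⟪val x.1, op v1⟫_ℝ = ⟪val u1, val v1⟫_ℝ := (inner_dstar2 y v1).symm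
    have a2 : ⟪val (x.2 : GraphSpace C.dstar3), op v2⟫_ℝ =
        ⟪op (x.2 : GraphSpace C.dstar3), val v2⟫_ℝ := (inner_dstar3 _ _).symm
    have a3 : ⟪val (x.2 : GraphSpace C.dstar3), (vp : L2Scal Ω)⟫_ℝ = 0 :=
      inner_harm3_orthogonal vp ⟨_, x.2.2⟩
    simp only [mixedForm, mixedData, a1, a2, a3, ← e2, hf3, ← e3, inner_add_left, inner_sub_left,
      real_inner_smul_left, h2, h2d]
    ring
  · have n2 : ‖u2‖ ≤ K * s := by
      refine le_trans ?_ hx1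
      rw [GraphSpace.norm_eq, norm_cap, h2, h2d]
      linarith [norm_nonneg (capDstar x.1)]
    have n3 : ‖val (x.2 : GraphSpace C.dstar3)‖ ≤ K * s := (GraphSpace.norm_val_le _).trans hx2
    have n1 : ‖op u1‖ ≤ ν⁻¹ * ((1 + (‖l3‖ + ‖l5‖ + 1) * K) * s) := by
      have e : op u1 = ν⁻¹ • (f2 - l3 (val u1) - l5 (val x.1) + op (x.2 : GraphSpace C.dstar3)) := by
        rw [eq_inv_smul_iff₀ hν.ne', ← e2]
        abel
      rw [e, norm_smul, Real.norm_eq_abs, abs_of_pos (inv_pos.2 hν)]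
      refine mul_le_mul_of_nonneg_left ?_ (inv_pos.2 hν).le
      have b1 := l3.le_opNorm_of_le ((norm_capDstar_le x.1).trans hx1)
      have b2 := l5.le_opNorm_of_le ((norm_val_cap_le x.1).trans hx1)
      have b3 := (norm_op_star3_le x.2).trans hx2
      have b4 : ‖f2‖ ≤ s := by linarith [norm_nonneg f3]
      have c1 := norm_add_le (f2 - l3 (val u1) - l5 (val x.1)) (op (x.2 : GraphSpace C.dstar3))
      have c2 := norm_sub_le (f2 - l3 (val u1)) (l5 (val x.1))
      have c3 := norm_sub_le f2 (l3 (val u1))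
      rw [h1] at c1 c2 c3 ⊢
      linarith
    have n1' : ‖val u1‖ ≤ K * s := (norm_capDstar_le x.1).trans hx1
    have n4 : ‖up‖ ≤ s := by linarith [norm_nonneg f2]
    have e1 := GraphSpace.norm_eq u1
    change ‖u1‖ + ‖u2‖ + ‖val (x.2 : GraphSpace C.dstar3)‖ + ‖up‖ ≤ _
    rw [e1]
    linarith

/-! ### Uniqueness -/

theorem mixedForm_sub (u u' v : C.MixedSpace) :
    C.mixedForm ν l3 l5 (u - u') v = C.mixedForm ν l3 l5 u v - C.mixedForm ν l3 l5 u' v := by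
  obtain ⟨u1, u2, u3, up⟩ := u
  obtain ⟨u1', u2', u3', up'⟩ := u'
  obtain ⟨v1, v2, v3, vp⟩ := v
  simp only [mixedForm, Prod.mk_sub_mk, map_sub, Submodule.coe_sub, inner_sub_left]
  ring

theorem eq_zero_of_mixedForm_eq_zero (hL : (C.primalOp ν l3 l5).IsInvertible) (u : C.MixedSpace)
    (hu : ∀ v, C.mixedForm ν l3 l5 u v = 0) : u = 0 := by
  obtain ⟨u1, u2, u3, up⟩ := u
  have t1 : ∀ v : C.V1, ⟪val u1, val v⟫_ℝ = ⟪val u2, op v⟫_ℝ := fun v => by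
    have h := hu (v, 0, 0, 0)
    simp only [mixedForm, map_zero, inner_zero_right, Submodule.coe_zero, mul_zero, add_zero,
      sub_zero] at h
    linarith
  have t2 : ∀ v : C.V2, ⟪ν • op u1 + l3 (val u1) + l5 (val u2), val v⟫_ℝ = ⟪u3, op v⟫_ℝ :=
    fun v => by
    have h := hu (0, v, 0, 0)
    simp only [mixedForm, map_zero, inner_zero_right, Submodule.coe_zero, add_zero,
      sub_zero, zero_add] at h
    simp only [inner_add_left, real_inner_smul_left]
    linarith
  have t3 : op u2 + (up : L2Scal Ω) = 0 := by
    have h := hu (0, 0, op u2 + (up : L2Scal Ω), 0)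
    simp only [mixedForm, map_zero, inner_zero_right, Submodule.coe_zero, add_zero, mul_zero,
      sub_zero, zero_add] at h
    rwa [← inner_add_left, inner_self_eq_zero] at h
  have t4 : u3 ∈ C.harm3ᗮ := (Submodule.mem_orthogonal' _ _).2 fun q hq => by
    have h := hu (0, 0, 0, ⟨q, hq⟩)
    simpa only [mixedForm, map_zero, inner_zero_right, add_zero, mul_zero,
      sub_zero, zero_add] using h
  -- `up` is orthogonal to `d u₂`, which equals `-up`.
  have hup : (up : L2Scal Ω) = 0 := by
    have h := inner_harm3_op up u2
    rw [eq_neg_of_add_eq_zero_left t3, inner_neg_right, neg_eq_zero, inner_self_eq_zero] at h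
    exact h
  have hd2 : op u2 = 0 := by rwa [hup, add_zero] at t3
  obtain ⟨y, hy1, hy2⟩ := exists_vStar2 t1
  obtain ⟨p, hp1, hp2⟩ := exists_vStar3 t2
  obtain ⟨x, hx1, hx2, hx3⟩ := exists_vCap2 u2 y hy1.symm
  have hpm : p ∈ C.VStar3 := by
    rw [Submodule.mem_comap, hp1]
    exact t4
  -- The value of `d* p` supplied by `t2` cancels the remaining terms once `d*` is moved off the
  -- test function.
  have hzero : C.primalOp ν l3 l5 (x, ⟨p, hpm⟩) = 0 := by
    refine ContinuousLinearMap.ext fun z => ?_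
    change C.primalForm ν l3 l5 (x, ⟨p, hpm⟩) z = 0
    have hadj := inner_dstar2 z.1 u1
    rw [real_inner_comm, real_inner_comm (op u1)] at hadj
    simp only [primalForm, hx1, hx2, hx3, hy2, hp2, hd2, inner_zero_left, add_zero,
      inner_add_left, inner_sub_left, real_inner_smul_left, hadj]
    ring
  have hxp : ((x, ⟨p, hpm⟩) : C.PrimalSpace) = 0 := by
    rw [← hL.inverse_apply_self (x, ⟨p, hpm⟩), hzero, map_zero]
  have hx : x = 0 := congrArg Prod.fst hxp
  have hp : p = 0 := congrArg (fun z : C.PrimalSpace => (z.2 : GraphSpace C.dstar3)) hxp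
  have z1 : val u1 = 0 := by rw [← hy2, ← hx3, hx]; simp [capDstar]
  have z2 : val u2 = 0 := by rw [← hx1, hx, map_zero]
  have z3 : u3 = 0 := by rw [← hp1, hp, map_zero]
  have w1 : u1 = 0 := Subtype.ext z1
  have w2 : u2 = 0 := Subtype.ext z2
  have w4 : up = 0 := Subtype.ext hup
  rw [w1, w2, z3, w4]
  rfl

theorem IsMixedSolution.unique (hL : (C.primalOp ν l3 l5).IsInvertible) {R : C.MixedSpace → ℝ}
    {u u' : C.MixedSpace} (hu : C.IsMixedSolution ν l3 l5 R u)
    (hu' : C.IsMixedSolution ν l3 l5 R u') : u' = u :=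
  sub_eq_zero.1 <| eq_zero_of_mixedForm_eq_zero hL _ fun v => by
    rw [mixedForm_sub, hu v, hu' v, sub_self]

/-! ### General functionals -/

theorem exists_representation (F : StrongDual ℝ C.MixedSpace) :
    ∃ (a : C.V1) (b : C.V2) (f3 : L2Scal Ω) (fp : C.harm3),
      (∀ v1 v2 v3 vp, F (v1, v2, v3, vp) = ⟪val a, val v1⟫_ℝ + ⟪op a, op v1⟫_ℝ
        + (⟪val b, val v2⟫_ℝ + ⟪op b, op v2⟫_ℝ) + ⟪f3, v3⟫_ℝ
        + ⟪(fp : L2Scal Ω), (vp : L2Scal Ω)⟫_ℝ) ∧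
      ‖a‖ ≤ 4 * ‖F‖ ∧ ‖b‖ ≤ 4 * ‖F‖ ∧ ‖f3‖ ≤ ‖F‖ ∧ ‖fp‖ ≤ ‖F‖ := by
  have : CompleteSpace C.harm3 := (Submodule.isClosed_orthogonal _).completeSpace_coe
  have hF := norm_nonneg F
  -- The product carries the maximum norm, so each coordinate embedding is isometric and loses no
  -- constant.
  have hn : ∀ {r : ℝ} (v : C.MixedSpace), ‖v‖ ≤ r → |F v| ≤ ‖F‖ * r :=
    fun v hv => F.le_opNorm_of_le hv
  obtain ⟨a, ha, hna⟩ := GraphSpace.exists_riesz C.closed1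
    (F.toLinearMap ∘ₗ LinearMap.inl ℝ _ _) hF (fun v => hn _ (by simp [Prod.norm_def]))
  obtain ⟨b, hb, hnb⟩ := GraphSpace.exists_riesz C.closed2
    (F.toLinearMap ∘ₗ LinearMap.inr ℝ _ _ ∘ₗ LinearMap.inl ℝ _ _) hF
    (fun v => hn _ (by simp [Prod.norm_def]))
  obtain ⟨f3, h3, hn3⟩ := exists_riesz_hilbert
    (F.toLinearMap ∘ₗ LinearMap.inr ℝ _ _ ∘ₗ LinearMap.inr ℝ _ _ ∘ₗ LinearMap.inl ℝ _ _) hF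
    (fun v => hn _ (by simp [Prod.norm_def]))
  obtain ⟨fp, hp, hnp⟩ := exists_riesz_hilbert
    (F.toLinearMap ∘ₗ LinearMap.inr ℝ _ _ ∘ₗ LinearMap.inr ℝ _ _ ∘ₗ LinearMap.inr ℝ _ _) hF
    (fun v => hn _ (by simp [Prod.norm_def]))
  refine ⟨a, b, f3, fp, fun v1 v2 v3 vp => ?_, hna, hnb, hn3, hnp⟩
  have hsum : ((v1, v2, v3, vp) : C.MixedSpace) =
      (v1, 0, 0, 0) + (0, v2, 0, 0) + (0, 0, v3, 0) + (0, 0, 0, vp) := by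
    simp
  rw [hsum, map_add, map_add, map_add, ← ha, ← hb, ← h3]
  exact congrArg _ (hp vp)

theorem exists_solution_of_functional (hΩ : IsOpen Ω) (hν : 0 < ν) {c : ℝ} (hc : 0 < c)
    (hsol : ∀ (f2 : L2Vec Ω) (f3 : L2Scal Ω), ∃ u : C.MixedSpace,
      C.IsMixedSolution ν l3 l5 (C.mixedData f2 f3) u ∧ C.normV u ≤ c * (‖f2‖ + ‖f3‖))
    (F : StrongDual ℝ C.MixedSpace) :
    ∃ u : C.MixedSpace, C.IsMixedSolution ν l3 l5 F u ∧
      C.normV u ≤ (c * (5 + 4 * ν + 4 * ‖l3‖ + 4 * ‖l5‖) + 13) * ‖F‖ := by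
  obtain ⟨a, b, f3, fp, hF, ha, hb, h3, hp⟩ := exists_representation F
  -- Against `d V²` the component `q` acts like `d b`, and it is also orthogonal to every `v_p`.
  obtain ⟨h, q, hq, -, hqn⟩ := C.exists_harm3_decomposition (op b)
  let w : C.V2 := ⟨op a, C.maps_domain a⟩
  have hw : val w = op a := rfl
  have hdw : op w = 0 := op_op_eq_zero hΩ a w hw
  obtain ⟨⟨u1, u2, u3, up⟩, hu, hun⟩ :=
    -- The data is `b` minus what the shift `(a, -da, fp - q, 0)` contributes to the `v₂` row. In
    -- the constant, `5 + ...` bounds this data together with `f3`, and `13 = 4 + 4 + 1 + 4` bounds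
    -- `a`, `w`, `fp` and `q`.
    hsol (val b - ν • op a - l3 (val a) + l5 (op a)) f3
  refine ⟨(u1 + a, u2 - w, u3 + fp - q, up), ?_, ?_⟩
  · rintro ⟨v1, v2, v3, vp⟩
    have e := hu (v1, v2, v3, vp)
    have e1 : ⟪op b, op v2⟫_ℝ = ⟪(q : L2Scal Ω), op v2⟫_ℝ := by
      rw [hq, inner_add_left, inner_harm3_op, zero_add]
    have e2 := inner_harm3_op fp v2
    have e3 := inner_harm3_orthogonal vp q
    simp only [mixedForm, mixedData, inner_add_left, inner_sub_left, real_inner_smul_left] at e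
    rw [hF]
    simp only [mixedForm, map_add, map_sub, inner_add_left, inner_sub_left, hw, hdw, e1, e2, e3,
      sub_zero]
    linear_combination e
  · have hwn : ‖w‖ = ‖op a‖ := by rw [GraphSpace.norm_eq, hw, hdw, norm_zero, add_zero]
    have na1 := (GraphSpace.norm_val_le a).trans ha
    have na2 := (GraphSpace.norm_op_le a).trans ha
    have nb1 := (GraphSpace.norm_val_le b).trans hb
    have nb2 := (GraphSpace.norm_op_le b).trans hb
    have n1 := norm_add_le u1 a
    have n2 := norm_sub_le u2 w
    have n3 := norm_sub_le (u3 + fp) (q : L2Scal Ω)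
    have n4 := norm_add_le u3 (fp : L2Scal Ω)
    have hf2 : ‖val b - ν • op a - l3 (val a) + l5 (op a)‖ ≤
        (4 + 4 * ν + 4 * ‖l3‖ + 4 * ‖l5‖) * ‖F‖ := by
      have m1 := norm_add_le (val b - ν • op a - l3 (val a)) (l5 (op a))
      have m2 := norm_sub_le (val b - ν • op a) (l3 (val a))
      have m3 := norm_sub_le (val b) (ν • op a)
      have m4 := l3.le_opNorm_of_le na1
      have m5 := l5.le_opNorm_of_le na2
      have m6 : ‖ν • op a‖ ≤ ν * (4 * ‖F‖) := by
        rw [norm_smul, Real.norm_eq_abs, abs_of_pos hν]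
        exact mul_le_mul_of_nonneg_left na2 hν.le
      linarith
    have hun' : ‖u1‖ + ‖u2‖ + ‖u3‖ + ‖up‖ ≤
        c * ((4 + 4 * ν + 4 * ‖l3‖ + 4 * ‖l5‖) * ‖F‖ + ‖F‖) :=
      hun.trans (mul_le_mul_of_nonneg_left (add_le_add hf2 h3) hc.le)
    have hp' : ‖(fp : L2Scal Ω)‖ ≤ ‖F‖ := hp
    have hq' : ‖(q : L2Scal Ω)‖ ≤ 4 * ‖F‖ := hqn.trans nb2
    change ‖u1 + a‖ + ‖u2 - w‖ + ‖u3 + (fp : L2Scal Ω) - (q : L2Scal Ω)‖ + ‖up‖ ≤ _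
    linarith

end DeRhamDomain

end VorticityMixed

theorem mainTheorem3
    (Ω : Set VorticityMixed.R3) (hΩ : IsOpen Ω) (hbdd : Bornology.IsBounded Ω)
    (C : VorticityMixed.DeRhamDomain Ω)
    (ν : ℝ) (hν : 0 < ν)
    (l3 l5 : VorticityMixed.L2Vec Ω →L[ℝ] VorticityMixed.L2Vec Ω)
    (hL : (C.primalOp ν l3 l5).IsInvertible)
    (hL' : (C.dualOp ν l3 l5).IsInvertible)
    (hreg : C.Regularity ν l3 l5) :
    -- unique solvability and stability for data `f₂ ∈ W²`, `f₃ ∈ W³`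
    (∃ c : ℝ, 0 < c ∧ ∀ (f2 : VorticityMixed.L2Vec Ω) (f3 : VorticityMixed.L2Scal Ω),
      ∃ u : C.MixedSpace, C.IsMixedSolution ν l3 l5 (C.mixedData f2 f3) u ∧
        (∀ u' : C.MixedSpace, C.IsMixedSolution ν l3 l5 (C.mixedData f2 f3) u' → u' = u) ∧
        C.normV u ≤ c * (‖f2‖ + ‖f3‖)) ∧
    -- the same for an arbitrary bounded functional on `V` as right-hand side
    (∃ c : ℝ, 0 < c ∧ ∀ F : StrongDual ℝ C.MixedSpace,
      ∃ u : C.MixedSpace, C.IsMixedSolution ν l3 l5 F u ∧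
        (∀ u' : C.MixedSpace, C.IsMixedSolution ν l3 l5 F u' → u' = u) ∧
        C.normV u ≤ c * ‖F‖) := by
  obtain ⟨c, hc, hsol⟩ := VorticityMixed.DeRhamDomain.exists_solution_of_data hν hL hreg.1
  refine ⟨⟨c, hc, fun f2 f3 => ?_⟩,
    ⟨c * (5 + 4 * ν + 4 * ‖l3‖ + 4 * ‖l5‖) + 13, by positivity, fun F => ?_⟩⟩
  · obtain ⟨u, hu, hn⟩ := hsol f2 f3
    exact ⟨u, hu, fun u' hu' => hu.unique hL hu', hn⟩
  · obtain ⟨u, hu, hn⟩ :=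
      VorticityMixed.DeRhamDomain.exists_solution_of_functional hΩ hν hc hsol F
    exact ⟨u, hu, fun u' hu' => hu.unique hL hu', hn⟩
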